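/- For real $\alpha>-1$ and real $\mu,z$ let $$\phi(\alpha,\mu;z)=\sum_{n=0}^{\infty}\frac{z^n}{n!\,\Gamma(\alpha n+\mu)}$$ be the Wright function, where $1/\Gamma$ is taken to be $0$ at the poles of $\Gamma$. Let $g$ be a real- or complex-valued function that is absolutely integrable on every finite interval $(0,T)$, $T>0$, and continuous at the point $t=1$. Suppose that there are real numbers $\sigma>0$ and $\delta$ such that $g(t)=O\bigl(\exp\{\sigma t^{\delta}\}\bigr)$ as $t\to\infty$. Then for every $\beta\in(0,1)$ with $\delta<\frac{1}{1-\beta}$ the integral $\int_0^\infty g(t)\,\phi(-\beta,1-\beta;-t)\,dt$ converges absolutely (the condition on $\beta$ holds for all $\beta<1$ sufficiently close to $1$), and $$\lim_{\beta\to 1^-}\int_0^\infty g(t)\,\phi(-\beta,1-\beta;-t)\,dt=g(1).$$ -/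

import Mathlib

open Set Filter Topology MeasureTheory Asymptotics

/-- The Wright function `φ(α, μ; z) = ∑_{n ≥ 0} z ^ n / (n! Γ(α n + μ))` of real arguments.
At the poles of `Γ` the coefficient `1 / Γ` is `0`, as usual: `Real.Gamma` takes the value `0`
there and division by `0` gives `0`. The series converges absolutely for `-1 < α`. -/
noncomputable def wrightPhi (α μ z : ℝ) : ℝ :=
  ∑' n : ℕ, z ^ n / ((n.factorial : ℝ) * Real.Gamma (α * (n : ℝ) + μ))

/-! For each `β`, `t ↦ φ(-β, 1-β; -t)` is a probability density on `(0, ∞)`, and as `β → 1⁻` its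
mass concentrates at `t = 1`; the limit is that of an approximate identity.

Positivity and decay come from a discrete model. The power series of `(1-x)^(-μ) exp(-l (1-x)^β)`
has nonnegative coefficients for `μ ≥ 0`, and its `k`-th coefficient at `l = t k^β`, multiplied by
`k^(1-μ)`, tends to `φ(-β, μ; -t)` (`tendsto_rpow_mul_expCoeff`). Evaluating the generating function
at `x = 1 - c/k` bounds that coefficient, and in the limit gives a Chernoff-type bound with a free
parameter `c` (`wrightPhi_neg_le`), first for `μ ≥ 1`, then for `μ ≥ 1-β` through a recurrence in
`μ`. Optimizing `c` gives decay like `exp(-(1-β)(βt)^(1/(1-β)))` up to a power of `1 + t`, hence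
absolute convergence and, as `β → 1⁻`, collapse on `[a, ∞)` for each `a > 1`.

On `[0, T]` with `T < 1`, the reflection formula makes every series coefficient `O(1-β)`. The mass
on `(0, 2]` is `1 - φ(-β, 1; -2) → 1` by an explicit primitive. A peak-function theorem on `(0, 2]`
and a dominated tail on `(2, ∞)` finish. -/

/-! ### Binomial coefficients and the reciprocal Gamma function -/

/-- The coefficient of `x ^ k` in the power series of `(1 - x) ^ (-s)`. -/
noncomputable def binCoeff (s : ℝ) (k : ℕ) : ℝ :=
  ∏ j ∈ Finset.range k, (s + j) / (j + 1)

theorem binCoeff_succ (s : ℝ) (k : ℕ) :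
    binCoeff s (k + 1) = binCoeff s k * ((s + k) / (k + 1)) := by
  rw [binCoeff, Finset.prod_range_succ, binCoeff]

/-- Coefficient form of `d/dx (1-x)^(-s) = s (1-x)^(-s-1)`. -/
theorem succ_mul_binCoeff_succ (s : ℝ) (k : ℕ) :
    ((k : ℝ) + 1) * binCoeff s (k + 1) = s * binCoeff (s + 1) k := by
  induction k with
  | zero => simp [binCoeff]
  | succ k ih =>
    rw [binCoeff_succ s (k + 1), binCoeff_succ (s + 1) k]
    have h1 : (k : ℝ) + 1 ≠ 0 := by positivity
    have h2 : (k : ℝ) + 1 + 1 ≠ 0 := by positivity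
    push_cast
    field_simp
    linear_combination (s + k + 1) * ih

theorem binCoeff_eq_choose (s : ℝ) (k : ℕ) :
    binCoeff s k = (-1) ^ k * Ring.choose (-s) k := by
  rw [Ring.choose_eq_smul]
  induction k with
  | zero => simp [binCoeff]
  | succ k ih =>
    have h1 : (k : ℝ) + 1 ≠ 0 := by positivity
    have h2 : ((k.factorial : ℕ) : ℝ) ≠ 0 := by positivity
    rw [binCoeff_succ, ih, descPochhammer_succ_right, Polynomial.smeval_mul]
    simp only [Polynomial.smeval_sub, Polynomial.smeval_X, Polynomial.smeval_natCast, pow_one,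
      Nat.factorial_succ, smul_eq_mul, Nat.cast_mul, Nat.cast_succ, pow_zero, nsmul_eq_mul, mul_one]
    field_simp
    ring

theorem binCoeff_add (s t : ℝ) (k : ℕ) :
    binCoeff (s + t) k =
      ∑ ij ∈ Finset.HasAntidiagonal.antidiagonal k, binCoeff s ij.1 * binCoeff t ij.2 := by
  rw [binCoeff_eq_choose, neg_add, Ring.add_choose_eq k (Commute.all _ _), Finset.mul_sum]
  refine Finset.sum_congr rfl fun ij hij => ?_
  rw [binCoeff_eq_choose, binCoeff_eq_choose, ← Finset.HasAntidiagonal.mem_antidiagonal.1 hij, pow_add]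
  ring

theorem binCoeff_one (k : ℕ) : binCoeff 1 k = 1 := by
  refine Finset.prod_eq_one fun j _ => ?_
  rw [add_comm]
  exact div_self (by positivity)

theorem binCoeff_nonneg {s : ℝ} (hs : 0 ≤ s) (k : ℕ) : 0 ≤ binCoeff s k :=
  Finset.prod_nonneg fun _ _ => by positivity

theorem abs_binCoeff_le {s t : ℝ} (hst : |s| ≤ t) (k : ℕ) : |binCoeff s k| ≤ binCoeff t k := by
  rw [binCoeff, binCoeff, Finset.abs_prod]
  refine Finset.prod_le_prod (fun _ _ => abs_nonneg _) fun j _ => ?_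
  rw [abs_div, abs_of_pos (by positivity : (0 : ℝ) < j + 1)]
  gcongr
  exact (abs_add_le _ _).trans (by simpa using hst)

theorem hasSum_binCoeff (s : ℝ) {x : ℝ} (hx0 : 0 ≤ x) (hx1 : x < 1) :
    HasSum (fun k => binCoeff s k * x ^ k) ((1 - x) ^ (-s)) := by
  have h := (Real.one_add_rpow_hasFPowerSeriesOnBall_zero (a := -s)).hasSum (y := -x)
    (by simpa [enorm_eq_nnnorm, ← NNReal.coe_lt_coe, abs_of_nonneg hx0] using hx1)
  rw [zero_add, ← sub_eq_add_neg] at h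
  have e : (fun k => binCoeff s k * x ^ k) =
      fun k => binomialSeries ℝ (-s) k fun _ => -x := by
    ext k
    rw [binomialSeries_apply, binCoeff_eq_choose]
    simp only [List.ofFn_const, List.prod_replicate, smul_eq_mul, neg_pow x]
    ring
  rw [e]
  exact h

/-- Euler's limit formula for `Γ`. At a pole the product eventually contains a zero factor, matching
the convention `1/Γ = 0`. -/
theorem tendsto_rpow_mul_binCoeff (s : ℝ) :
    Tendsto (fun k : ℕ => (k : ℝ) ^ (1 - s) * binCoeff s k) atTop (𝓝 (Real.Gamma s)⁻¹) := by
  by_cases hs : ∃ m : ℕ, s = -m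
  · obtain ⟨m, rfl⟩ := hs
    rw [Real.Gamma_neg_nat_eq_zero, inv_zero]
    refine tendsto_const_nhds.congr' ?_
    filter_upwards [eventually_gt_atTop m] with k hk
    rw [binCoeff, Finset.prod_eq_zero (Finset.mem_range.2 hk) (by simp), mul_zero]
  · have hs' : ∀ m : ℕ, s ≠ -m := fun m hm => hs ⟨m, hm⟩
    -- `GammaSeq` has one more factor `s + k` in its denominator than `binCoeff`; the correction
    -- `k/(s+k)` is written as `1 - s/(s+k)`.
    have h1 : Tendsto (fun k : ℕ => (Real.GammaSeq s k)⁻¹ * (1 - s / (s + k))) atTop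
        (𝓝 ((Real.Gamma s)⁻¹ * (1 - 0))) := by
      refine ((Real.GammaSeq_tendsto_Gamma s).inv₀ (Real.Gamma_ne_zero hs')).mul
        (tendsto_const_nhds.sub ?_)
      exact tendsto_const_nhds.div_atTop
        (tendsto_atTop_add_const_left _ _ tendsto_natCast_atTop_atTop)
    rw [sub_zero, mul_one] at h1
    refine h1.congr' ?_
    filter_upwards [eventually_gt_atTop 0] with k hk
    have hk' : (0 : ℝ) < k := by exact_mod_cast hk
    have hsk : s + k ≠ 0 := fun h => hs' k (by linarith)
    have hf : ∏ j ∈ Finset.range k, ((j : ℝ) + 1) = k.factorial := by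
      rw [← Finset.prod_range_add_one_eq_factorial]; push_cast; rfl
    rw [Real.GammaSeq, binCoeff, Finset.prod_div_distrib, hf, Finset.prod_range_succ,
      Real.rpow_sub hk', Real.rpow_one, inv_div]
    have : (k.factorial : ℝ) ≠ 0 := by positivity
    have : (k : ℝ) ^ s ≠ 0 := by positivity
    field_simp
    ring

/-! ### Bounds uniform in `k`, for dominated convergence -/

theorem prod_range_div_le_exp {y : ℝ} (hy : 0 ≤ y) (m : ℕ) :
    ∏ j ∈ Finset.range m, y / ((j : ℝ) + 1) ≤ Real.exp y := by
  have hf : ∏ j ∈ Finset.range m, ((j : ℝ) + 1) = m.factorial := by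
    rw [← Finset.prod_range_add_one_eq_factorial]; push_cast; rfl
  rw [Finset.prod_div_distrib, hf, Finset.prod_const, Finset.card_range]
  exact Real.pow_div_factorial_le_exp _ hy m

theorem sum_range_inv_eq_harmonic (n : ℕ) :
    ∑ j ∈ Finset.range n, 1 / ((j : ℝ) + 1) = (harmonic n : ℝ) := by
  simp [harmonic]

theorem log_le_sum_range_inv (n : ℕ) :
    Real.log n ≤ ∑ j ∈ Finset.range n, 1 / ((j : ℝ) + 1) := by
  rw [sum_range_inv_eq_harmonic]
  refine le_trans ?_ (log_add_one_le_harmonic n)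
  rcases Nat.eq_zero_or_pos n with rfl | hn
  · simp
  · exact Real.log_le_log (by exact_mod_cast hn) (by push_cast; linarith)

theorem sum_range_inv_le (n : ℕ) :
    ∑ j ∈ Finset.range n, 1 / ((j : ℝ) + 1) ≤ 1 + Real.log n := by
  rw [sum_range_inv_eq_harmonic]
  exact harmonic_le_one_add_log n

/-- The product is `∏ |1 - y/(j+1)|`. Factors with `j + 1 ≤ y` are at most `y/(j+1)` and contribute
at most `e^y`; the others are at most `exp(-y/(j+1))`, and the harmonic sum cancels `k^y`. The bound
is free of `k`. -/
theorem rpow_mul_abs_binCoeff_le {y Y : ℝ} (hY : 1 ≤ Y) (hyY : |y| ≤ Y) {k : ℕ} (hk : 0 < k) :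
    (k : ℝ) ^ y * |binCoeff (1 - y) k| ≤ Real.exp (2 * Y) * Y ^ Y := by
  have hk' : (0 : ℝ) < k := by exact_mod_cast hk
  have hY0 : 0 < Y := by linarith
  have habs : |binCoeff (1 - y) k| = ∏ j ∈ Finset.range k, |1 - y / ((j : ℝ) + 1)| := by
    rw [binCoeff, Finset.abs_prod]
    refine Finset.prod_congr rfl fun j _ => ?_
    congr 1
    field_simp
    ring
  have hYY : Y ^ Y = Real.exp (Y * Real.log Y) := by
    rw [Real.rpow_def_of_pos hY0, mul_comm]
  have hky : (k : ℝ) ^ y = Real.exp (y * Real.log k) := by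
    rw [Real.rpow_def_of_pos hk', mul_comm]
  have hlogY : 0 ≤ Real.log Y := Real.log_nonneg hY
  have hlogk : 0 ≤ Real.log k := Real.log_nonneg (by exact_mod_cast hk)
  have hyY' : y ≤ Y := (le_abs_self y).trans hyY
  rw [habs]
  rcases lt_or_ge y 0 with hy | hy
  · have h1 : ∏ j ∈ Finset.range k, |1 - y / ((j : ℝ) + 1)| ≤
        Real.exp (-y * (1 + Real.log k)) := by
      calc ∏ j ∈ Finset.range k, |1 - y / ((j : ℝ) + 1)|
          ≤ ∏ j ∈ Finset.range k, Real.exp (-y * (1 / ((j : ℝ) + 1))) := by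
            refine Finset.prod_le_prod (fun _ _ => abs_nonneg _) fun j _ => ?_
            have : 0 ≤ -y / ((j : ℝ) + 1) := div_nonneg (by linarith) (by positivity)
            rw [neg_div] at this
            rw [abs_of_nonneg (by linarith)]
            have := Real.add_one_le_exp (-y * (1 / ((j : ℝ) + 1)))
            calc _ = -y * (1 / ((j : ℝ) + 1)) + 1 := by ring
              _ ≤ _ := this
        _ = Real.exp (-y * ∑ j ∈ Finset.range k, 1 / ((j : ℝ) + 1)) := by
            rw [← Real.exp_sum, Finset.mul_sum]
        _ ≤ _ := by
            refine Real.exp_le_exp.2 (mul_le_mul_of_nonneg_left (sum_range_inv_le k) (by linarith))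
    rw [hky, hYY]
    calc _ ≤ Real.exp (y * Real.log k) * Real.exp (-y * (1 + Real.log k)) := by gcongr
      _ = Real.exp (-y) := by rw [← Real.exp_add]; congr 1; ring
      _ ≤ Real.exp (2 * Y + Y * Real.log Y) := by
          refine Real.exp_le_exp.2 ?_
          have := neg_abs_le y
          nlinarith [mul_nonneg hY0.le hlogY]
      _ = _ := Real.exp_add _ _
  · set m := ⌊y⌋₊ with hm
    have hmy : (m : ℝ) ≤ y := Nat.floor_le hy
    have hsmall : ∀ j < m, |1 - y / ((j : ℝ) + 1)| ≤ y / ((j : ℝ) + 1) := by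
      intro j hj
      have hj1 : (j : ℝ) + 1 ≤ y := le_trans (by exact_mod_cast hj) hmy
      have : 1 ≤ y / ((j : ℝ) + 1) := (one_le_div (by positivity)).2 hj1
      rw [abs_of_nonpos (by linarith)]
      linarith
    rcases le_or_gt k m with hkm | hkm
    · have h1 : ∏ j ∈ Finset.range k, |1 - y / ((j : ℝ) + 1)| ≤ Real.exp y :=
        (Finset.prod_le_prod (fun _ _ => abs_nonneg _) fun j hj =>
          hsmall j ((Finset.mem_range.1 hj).trans_le hkm)).trans (prod_range_div_le_exp hy k)
      have hkY : (k : ℝ) ≤ Y := le_trans (by exact_mod_cast hkm) (hmy.trans hyY')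
      have h2 : (k : ℝ) ^ y ≤ Y ^ Y :=
        (Real.rpow_le_rpow hk'.le hkY hy).trans (Real.rpow_le_rpow_of_exponent_le hY hyY')
      calc _ ≤ Y ^ Y * Real.exp y := by gcongr
        _ ≤ Y ^ Y * Real.exp (2 * Y) := by
            gcongr
            linarith
        _ = _ := mul_comm _ _
    · have h1 : ∏ j ∈ Finset.range m, |1 - y / ((j : ℝ) + 1)| ≤ Real.exp y :=
        (Finset.prod_le_prod (fun _ _ => abs_nonneg _) fun j hj =>
          hsmall j (Finset.mem_range.1 hj)).trans (prod_range_div_le_exp hy m)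
      have h2 : ∏ j ∈ Finset.Ico m k, |1 - y / ((j : ℝ) + 1)| ≤
          Real.exp (-y * (Real.log k - (1 + Real.log m))) := by
        calc ∏ j ∈ Finset.Ico m k, |1 - y / ((j : ℝ) + 1)|
            ≤ ∏ j ∈ Finset.Ico m k, Real.exp (-y * (1 / ((j : ℝ) + 1))) := by
              refine Finset.prod_le_prod (fun _ _ => abs_nonneg _) fun j hj => ?_
              have hj1 : y ≤ (j : ℝ) + 1 := by
                have h3 := Nat.lt_floor_add_one y
                have h4 : (m : ℝ) ≤ j := by exact_mod_cast (Finset.mem_Ico.1 hj).1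
                linarith
              have : y / ((j : ℝ) + 1) ≤ 1 := (div_le_one (by positivity)).2 hj1
              rw [abs_of_nonneg (by linarith)]
              have := Real.add_one_le_exp (-y * (1 / ((j : ℝ) + 1)))
              calc _ = -y * (1 / ((j : ℝ) + 1)) + 1 := by ring
                _ ≤ _ := this
          _ = Real.exp (-y * ∑ j ∈ Finset.Ico m k, 1 / ((j : ℝ) + 1)) := by
              rw [← Real.exp_sum, Finset.mul_sum]
          _ ≤ _ := by
              refine Real.exp_le_exp.2 (mul_le_mul_of_nonpos_left ?_ (by linarith))
              rw [Finset.sum_Ico_eq_sub _ hkm.le]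
              exact sub_le_sub (log_le_sum_range_inv k) (sum_range_inv_le m)
      have h3 : y * Real.log m ≤ Y * Real.log Y := by
        rcases Nat.eq_zero_or_pos m with h0 | h0
        · rw [h0]; simp; positivity
        · have : Real.log m ≤ Real.log Y :=
            Real.log_le_log (by exact_mod_cast h0) (hmy.trans hyY')
          exact (mul_le_mul_of_nonneg_left this hy).trans
            (mul_le_mul_of_nonneg_right hyY' hlogY)
      rw [← Finset.prod_range_mul_prod_Ico _ hkm.le, hky, hYY]
      calc _ ≤ Real.exp (y * Real.log k) *
            (Real.exp y * Real.exp (-y * (Real.log k - (1 + Real.log m)))) := by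
              gcongr
        _ = Real.exp (2 * y + y * Real.log m) := by
            rw [← Real.exp_add, ← Real.exp_add]; congr 1; ring
        _ ≤ Real.exp (2 * Y + Y * Real.log Y) := Real.exp_le_exp.2 (by linarith)
        _ = _ := Real.exp_add _ _

theorem summable_wright_majorant {β b : ℝ} (hβ0 : 0 ≤ β) (hβ1 : β < 1) (hb : 1 ≤ b) (R : ℝ) :
    Summable fun n : ℕ => R ^ n / (n.factorial : ℝ) *
      (Real.exp (2 * (β * n + b)) * (β * n + b) ^ (β * n + b)) := by
  -- With `γ` strictly between `β` and `1`, eventually `y^y ≤ n^(γn)`, which loses to `n! ≥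
  -- (n/e)^n`. The constant `C` is what makes the total exponent at most `-n`.
  set γ : ℝ := (1 + β) / 2 with hγ
  have hγ1 : γ < 1 := by linarith
  have hβγ : 0 < γ - β := by linarith
  have hγ0 : 0 < γ := by linarith
  set C : ℝ := Real.log (|R| + 1) + 2 + 2 * γ with hC
  have hlog : ∀ᶠ n : ℕ in atTop, C ≤ (1 - γ) * Real.log n := by
    have : Tendsto (fun n : ℕ => (1 - γ) * Real.log n) atTop atTop :=
      (Real.tendsto_log_atTop.comp tendsto_natCast_atTop_atTop).const_mul_atTop (by linarith)
    exact this.eventually_ge_atTop C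
  have hlin : ∀ᶠ n : ℕ in atTop, b ≤ (γ - β) * n := by
    have : Tendsto (fun n : ℕ => (γ - β) * (n : ℝ)) atTop atTop :=
      tendsto_natCast_atTop_atTop.const_mul_atTop hβγ
    exact this.eventually_ge_atTop b
  refine summable_of_isBigO_nat (Real.summable_exp_neg_nat) (IsBigO.of_bound 1 ?_)
  filter_upwards [hlog, hlin, eventually_gt_atTop 0] with n h1 h2 hn
  have hn' : (0 : ℝ) < n := by exact_mod_cast hn
  set y : ℝ := β * n + b with hy
  have hy0 : 0 < y := by positivity
  have hyn : y ≤ γ * n := by linarith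
  have hyn' : y ≤ n := hyn.trans (by nlinarith)
  have hlogn : 0 ≤ Real.log n := Real.log_nonneg (by exact_mod_cast hn)
  have hyy : y ^ y ≤ Real.exp (γ * n * Real.log n) := by
    rw [Real.rpow_def_of_pos hy0, Real.exp_le_exp, mul_comm]
    calc y * Real.log y ≤ y * Real.log n := by gcongr
      _ ≤ γ * n * Real.log n := by gcongr
  have hR : |R| ^ n ≤ Real.exp (n * Real.log (|R| + 1)) := by
    rw [Real.exp_nat_mul, Real.exp_log (by positivity)]
    gcongr
    linarith
  have hfac : Real.exp (n * Real.log n - n) ≤ n.factorial := by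
    have h := Real.pow_div_factorial_le_exp (n : ℝ) hn'.le n
    rw [div_le_iff₀ (by positivity)] at h
    rw [Real.exp_sub, Real.exp_nat_mul, Real.exp_log hn', div_le_iff₀ (Real.exp_pos _), mul_comm]
    exact h
  rw [one_mul, Real.norm_eq_abs, Real.norm_eq_abs, abs_of_pos (Real.exp_pos _), abs_mul, abs_div,
    abs_pow, Nat.abs_cast, abs_of_pos (by positivity : 0 < Real.exp (2 * y) * y ^ y)]
  calc |R| ^ n / (n.factorial : ℝ) * (Real.exp (2 * y) * y ^ y)
      ≤ Real.exp (n * Real.log (|R| + 1)) / Real.exp (n * Real.log n - n) *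
        (Real.exp (2 * (γ * n)) * Real.exp (γ * n * Real.log n)) := by gcongr
    _ = Real.exp (n * Real.log (|R| + 1) - (n * Real.log n - n) +
          (2 * (γ * n) + γ * n * Real.log n)) := by
        rw [← Real.exp_sub, ← Real.exp_add, ← Real.exp_add]
    _ ≤ Real.exp (-n) := by
        refine Real.exp_le_exp.2 ?_
        nlinarith [mul_le_mul_of_nonneg_left h1 hn'.le]

/-! ### The generating function `(1-x)^(-μ) exp(-l (1-x)^β)` -/

/-- The coefficient of `x ^ k` in the power series of `(1 - x) ^ (-μ) * exp (-l * (1 - x) ^ β)`. -/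
noncomputable def expCoeff (β μ l : ℝ) (k : ℕ) : ℝ :=
  ∑' n : ℕ, (-l) ^ n / (n.factorial : ℝ) * binCoeff (μ - β * n) k

theorem abs_sub_mul_natCast_le {β : ℝ} (hβ : 0 ≤ β) (μ : ℝ) (n : ℕ) :
    |μ - β * n| ≤ |μ| + β * n := by
  refine (abs_sub _ _).trans ?_
  rw [abs_of_nonneg (by positivity : 0 ≤ β * (n : ℝ))]

theorem one_sub_rpow_neg_sub_mul_natCast (β μ : ℝ) {x : ℝ} (hx1 : x < 1) (n : ℕ) :
    (1 - x) ^ (-(μ - β * n)) = (1 - x) ^ (-μ) * ((1 - x) ^ β) ^ n := by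
  rw [← Real.rpow_natCast, ← Real.rpow_mul (by linarith), ← Real.rpow_add (by linarith)]
  congr 1
  ring

theorem summable_expCoeff_prod {β : ℝ} (hβ : 0 ≤ β) (μ l : ℝ) {x : ℝ} (hx0 : 0 ≤ x)
    (hx1 : x < 1) :
    Summable fun p : ℕ × ℕ =>
      (-l) ^ p.1 / (p.1.factorial : ℝ) * binCoeff (μ - β * p.1) p.2 * x ^ p.2 := by
  have hsum : ∀ n : ℕ, HasSum
      (fun k : ℕ => |l| ^ n / (n.factorial : ℝ) * (binCoeff (|μ| + β * n) k * x ^ k))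
      (|l| ^ n / (n.factorial : ℝ) * (1 - x) ^ (-(|μ| + β * n))) :=
    fun n => (hasSum_binCoeff _ hx0 hx1).mul_left _
  have hmaj : Summable fun p : ℕ × ℕ =>
      |l| ^ p.1 / (p.1.factorial : ℝ) * (binCoeff (|μ| + β * p.1) p.2 * x ^ p.2) := by
    rw [summable_prod_of_nonneg]
    · refine ⟨fun n => (hsum n).summable, ?_⟩
      simp_rw [fun n => (hsum n).tsum_eq]
      refine ((Real.summable_pow_div_factorial (|l| * (1 - x) ^ (-β))).mul_left
        ((1 - x) ^ (-|μ|))).congr fun n => ?_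
      have := one_sub_rpow_neg_sub_mul_natCast (-β) |μ| hx1 n
      rw [neg_mul, sub_neg_eq_add] at this
      rw [this, mul_pow]
      ring
    · intro p
      have := binCoeff_nonneg (by positivity : 0 ≤ |μ| + β * (p.1 : ℝ)) p.2
      dsimp only [Pi.zero_apply]
      positivity
  refine hmaj.of_norm_bounded fun p => ?_
  rw [norm_mul, norm_mul, norm_div, norm_pow, norm_pow, norm_neg, Real.norm_natCast,
    Real.norm_of_nonneg hx0, Real.norm_eq_abs, Real.norm_eq_abs, mul_assoc]
  gcongr
  exact abs_binCoeff_le (abs_sub_mul_natCast_le hβ μ p.1) p.2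

theorem summable_expCoeff {β : ℝ} (hβ : 0 ≤ β) (μ l : ℝ) (k : ℕ) :
    Summable fun n : ℕ => (-l) ^ n / (n.factorial : ℝ) * binCoeff (μ - β * n) k := by
  have h := (summable_expCoeff_prod hβ μ l (x := 1 / 2) (by norm_num) (by norm_num)).comp_injective
    (i := fun n : ℕ => (n, k)) fun a b h => (Prod.ext_iff.1 h).1
  refine (h.mul_right (((1 / 2 : ℝ) ^ k)⁻¹)).congr fun n => ?_
  simp only [Function.comp]
  field_simp

theorem hasSum_expCoeff {β : ℝ} (hβ : 0 ≤ β) (μ l : ℝ) {x : ℝ} (hx0 : 0 ≤ x) (hx1 : x < 1) :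
    HasSum (fun k => expCoeff β μ l k * x ^ k)
      ((1 - x) ^ (-μ) * Real.exp (-l * (1 - x) ^ β)) := by
  have hp := summable_expCoeff_prod hβ μ l hx0 hx1
  have hfib : ∀ k : ℕ, HasSum
      (fun n : ℕ => (-l) ^ n / (n.factorial : ℝ) * binCoeff (μ - β * n) k * x ^ k)
      (expCoeff β μ l k * x ^ k) :=
    fun k => (summable_expCoeff hβ μ l k).hasSum.mul_right _
  have hfib' : ∀ n : ℕ, HasSum
      (fun k : ℕ => (-l) ^ n / (n.factorial : ℝ) * binCoeff (μ - β * n) k * x ^ k)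
      ((1 - x) ^ (-μ) * ((-l * (1 - x) ^ β) ^ n / (n.factorial : ℝ))) := by
    intro n
    have := (hasSum_binCoeff (μ - β * n) hx0 hx1).mul_left ((-l) ^ n / (n.factorial : ℝ))
    rw [one_sub_rpow_neg_sub_mul_natCast β μ hx1 n] at this
    simp_rw [mul_assoc] at this ⊢
    have e : (1 - x) ^ (-μ) * ((-l * (1 - x) ^ β) ^ n / (n.factorial : ℝ)) =
        (-l) ^ n / (n.factorial : ℝ) * ((1 - x) ^ (-μ) * ((1 - x) ^ β) ^ n) := by
      rw [mul_pow]
      ring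
    rw [e]
    exact this
  have h1 := hp.hasSum.prod_fiberwise hfib'
  have h2 : HasSum (fun n : ℕ => (1 - x) ^ (-μ) * ((-l * (1 - x) ^ β) ^ n / (n.factorial : ℝ)))
      ((1 - x) ^ (-μ) * Real.exp (-l * (1 - x) ^ β)) := by
    refine HasSum.mul_left _ ?_
    rw [Real.exp_eq_exp_ℝ]
    exact NormedSpace.expSeries_div_hasSum_exp _
  rw [← h1.unique h2]
  exact ((Equiv.prodComm ℕ ℕ).hasSum_iff.2 hp.hasSum).prod_fiberwise hfib

/-- Cauchy product with `(1-x)^(-ν)`, obtained termwise from Vandermonde's identity. -/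
theorem expCoeff_add {β : ℝ} (hβ : 0 ≤ β) (μ ν l : ℝ) (k : ℕ) :
    expCoeff β (ν + μ) l k = ∑ ij ∈ Finset.HasAntidiagonal.antidiagonal k,
      binCoeff ν ij.1 * expCoeff β μ l ij.2 := by
  have h : HasSum (fun n : ℕ => ∑ ij ∈ Finset.HasAntidiagonal.antidiagonal k,
      binCoeff ν ij.1 * ((-l) ^ n / (n.factorial : ℝ) * binCoeff (μ - β * n) ij.2))
      (∑ ij ∈ Finset.HasAntidiagonal.antidiagonal k, binCoeff ν ij.1 * expCoeff β μ l ij.2) :=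
    hasSum_sum fun ij _ => (summable_expCoeff hβ μ l ij.2).hasSum.mul_left _
  rw [← h.tsum_eq, expCoeff]
  refine tsum_congr fun n => ?_
  rw [add_sub_assoc, binCoeff_add, Finset.mul_sum]
  exact Finset.sum_congr rfl fun _ _ => by ring

/-- Coefficient form of `F' = lβ (1-x)^(-(1-β)) F` for `F = exp(-l (1-x)^β)`. -/
theorem succ_mul_expCoeff_zero {β : ℝ} (hβ : 0 ≤ β) (l : ℝ) (k : ℕ) :
    ((k : ℝ) + 1) * expCoeff β 0 l (k + 1) = l * β * expCoeff β (1 - β) l k := by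
  have hs := (summable_expCoeff hβ 0 l (k + 1)).mul_left ((k : ℝ) + 1)
  rw [expCoeff, expCoeff, ← tsum_mul_left, ← tsum_mul_left, hs.tsum_eq_zero_add]
  have h0 : ((k : ℝ) + 1) * ((-l) ^ 0 / ((0 : ℕ).factorial : ℝ) *
      binCoeff (0 - β * (0 : ℕ)) (k + 1)) = 0 := by
    have := succ_mul_binCoeff_succ 0 k
    simp only [zero_mul] at this
    simp [this]
  rw [h0, zero_add]
  refine tsum_congr fun n => ?_
  have h1 := succ_mul_binCoeff_succ (0 - β * ((n + 1 : ℕ) : ℝ)) k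
  have h2 : (0 - β * ((n + 1 : ℕ) : ℝ)) + 1 = 1 - β - β * n := by push_cast; ring
  rw [h2] at h1
  rw [mul_left_comm, h1, pow_succ, Nat.factorial_succ]
  push_cast
  field_simp
  ring

/-- The differential equation expresses each coefficient as a nonnegative combination of earlier
ones, since `(1-x)^(-(1-β))` has nonnegative coefficients. -/
theorem expCoeff_zero_nonneg {β : ℝ} (hβ0 : 0 ≤ β) (hβ1 : β ≤ 1) {l : ℝ} (hl : 0 ≤ l) (k : ℕ) :
    0 ≤ expCoeff β 0 l k := by
  induction k using Nat.strong_induction_on with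
  | _ k ih =>
    rcases k with _ | k
    · have h : expCoeff β 0 l 0 = Real.exp (-l) := by
        simp only [expCoeff, binCoeff, Finset.range_zero, Finset.prod_empty, mul_one]
        rw [Real.exp_eq_exp_ℝ]
        exact (NormedSpace.expSeries_div_hasSum_exp (-l)).tsum_eq
      rw [h]
      positivity
    · have h := succ_mul_expCoeff_zero hβ0 l k
      have h' : 0 ≤ expCoeff β (1 - β) l k := by
        rw [← add_zero (1 - β), expCoeff_add hβ0]
        refine Finset.sum_nonneg fun ij hij => mul_nonneg (binCoeff_nonneg (by linarith) _)
          (ih _ (Nat.lt_succ_of_le ?_))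
        exact Finset.HasAntidiagonal.antidiagonal.snd_le hij
      have h2 : 0 ≤ ((k : ℝ) + 1) * expCoeff β 0 l (k + 1) := by
        rw [h]
        positivity
      exact nonneg_of_mul_nonneg_right h2 (by positivity)

theorem expCoeff_nonneg {β : ℝ} (hβ0 : 0 ≤ β) (hβ1 : β ≤ 1) {l μ : ℝ} (hl : 0 ≤ l) (hμ : 0 ≤ μ)
    (k : ℕ) : 0 ≤ expCoeff β μ l k := by
  rw [← add_zero μ, expCoeff_add hβ0]
  exact Finset.sum_nonneg fun ij _ => mul_nonneg (binCoeff_nonneg hμ _)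
    (expCoeff_zero_nonneg hβ0 hβ1 hl _)

/-- Since `(1-x)^(-1)` sums coefficients, the `k`-th one at `μ` is a partial sum of those at `μ -
1`, which are nonnegative; `x^k ≤ x^j` for `j ≤ k` then compares it with the full series. -/
theorem pow_mul_expCoeff_le {β : ℝ} (hβ0 : 0 ≤ β) (hβ1 : β ≤ 1) {l μ : ℝ} (hl : 0 ≤ l)
    (hμ : 1 ≤ μ) {x : ℝ} (hx0 : 0 ≤ x) (hx1 : x < 1) (k : ℕ) :
    x ^ k * expCoeff β μ l k ≤ (1 - x) ^ (1 - μ) * Real.exp (-l * (1 - x) ^ β) := by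
  have hnn : ∀ j, 0 ≤ expCoeff β (μ - 1) l j :=
    expCoeff_nonneg hβ0 hβ1 hl (by linarith)
  have h := hasSum_expCoeff hβ0 (μ - 1) l hx0 hx1
  rw [neg_sub] at h
  have hk : expCoeff β μ l k = ∑ j ∈ Finset.range (k + 1), expCoeff β (μ - 1) l j := by
    conv_lhs => rw [← add_sub_cancel 1 μ]
    rw [expCoeff_add hβ0]
    simp only [binCoeff_one, one_mul]
    rw [Finset.Nat.sum_antidiagonal_eq_sum_range_succ_mk,
      ← Finset.sum_range_reflect]
    refine Finset.sum_congr rfl fun j hj => ?_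
    congr 1
    have := Finset.mem_range.1 hj
    omega
  rw [hk, Finset.mul_sum]
  refine le_trans (Finset.sum_le_sum fun j hj => ?_)
    (sum_le_hasSum (Finset.range (k + 1)) (fun j _ => mul_nonneg (hnn j) (by positivity)) h)
  rw [mul_comm]
  refine mul_le_mul_of_nonneg_left ?_ (hnn j)
  exact pow_le_pow_of_le_one hx0 hx1.le (Nat.lt_succ_iff.1 (Finset.mem_range.1 hj))

/-! ### The Wright function as a scaling limit of coefficients -/

theorem wrightPhi_eq_tsum (β μ z : ℝ) :
    wrightPhi (-β) μ z =
      ∑' n : ℕ, z ^ n / (n.factorial : ℝ) * (Real.Gamma (μ - β * n))⁻¹ := by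
  refine tsum_congr fun n => ?_
  rw [show -β * (n : ℝ) + μ = μ - β * n by ring, div_mul_eq_div_div, div_eq_mul_inv _ (Real.Gamma _)]

theorem rpow_mul_abs_binCoeff_sub_le {β : ℝ} (hβ : 0 ≤ β) (μ : ℝ) (n : ℕ) {k : ℕ} (hk : 0 < k) :
    (k : ℝ) ^ (1 - (μ - β * n)) * |binCoeff (μ - β * n) k| ≤
      Real.exp (2 * (β * n + (|1 - μ| + 1))) *
        (β * n + (|1 - μ| + 1)) ^ (β * n + (|1 - μ| + 1)) := by
  have h0 : 0 ≤ β * (n : ℝ) := by positivity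
  have h := rpow_mul_abs_binCoeff_le (y := 1 - (μ - β * n)) (Y := β * n + (|1 - μ| + 1))
    (by have := abs_nonneg (1 - μ); linarith) ?_ hk
  · rwa [sub_sub_cancel] at h
  · have h1 := abs_add_le (1 - μ) (β * n)
    rw [abs_of_nonneg h0] at h1
    rw [show 1 - (μ - β * n) = 1 - μ + β * n by ring]
    linarith

theorem abs_inv_Gamma_sub_le {β : ℝ} (hβ : 0 ≤ β) (μ : ℝ) (n : ℕ) :
    |(Real.Gamma (μ - β * n))⁻¹| ≤
      Real.exp (2 * (β * n + (|1 - μ| + 1))) *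
        (β * n + (|1 - μ| + 1)) ^ (β * n + (|1 - μ| + 1)) := by
  refine le_of_tendsto (tendsto_rpow_mul_binCoeff (μ - β * n)).abs ?_
  filter_upwards [eventually_gt_atTop 0] with k hk
  rw [abs_mul, abs_of_nonneg (by positivity : 0 ≤ (k : ℝ) ^ (1 - (μ - β * n)))]
  exact rpow_mul_abs_binCoeff_sub_le hβ μ n hk

theorem summable_abs_wrightPhi {β : ℝ} (hβ0 : 0 ≤ β) (hβ1 : β < 1) (μ z : ℝ) :
    Summable fun n : ℕ => |z| ^ n / (n.factorial : ℝ) * |(Real.Gamma (μ - β * n))⁻¹| := by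
  refine (summable_wright_majorant hβ0 hβ1 (b := |1 - μ| + 1)
    (by have := abs_nonneg (1 - μ); linarith) |z|).of_nonneg_of_le (fun n => by positivity)
    fun n => ?_
  exact mul_le_mul_of_nonneg_left (abs_inv_Gamma_sub_le hβ0 μ n) (by positivity)

theorem summable_wrightPhi {β : ℝ} (hβ0 : 0 ≤ β) (hβ1 : β < 1) (μ z : ℝ) :
    Summable fun n : ℕ => z ^ n / (n.factorial : ℝ) * (Real.Gamma (μ - β * n))⁻¹ := by
  refine (summable_abs_wrightPhi hβ0 hβ1 μ z).of_norm_bounded fun n => ?_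
  rw [norm_mul, norm_div, norm_pow, Real.norm_natCast, Real.norm_eq_abs, Real.norm_eq_abs]

theorem tendsto_rpow_mul_expCoeff {β : ℝ} (hβ0 : 0 ≤ β) (hβ1 : β < 1) (μ t : ℝ) :
    Tendsto (fun k : ℕ => (k : ℝ) ^ (1 - μ) * expCoeff β μ (t * (k : ℝ) ^ β) k) atTop
      (𝓝 (wrightPhi (-β) μ (-t))) := by
  have h := tendsto_tsum_of_dominated_convergence (𝓕 := (atTop : Filter ℕ))
    (f := fun (k n : ℕ) => (-t) ^ n / (n.factorial : ℝ) *
      ((k : ℝ) ^ (1 - (μ - β * n)) * binCoeff (μ - β * n) k))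
    (g := fun n : ℕ => (-t) ^ n / (n.factorial : ℝ) * (Real.Gamma (μ - β * n))⁻¹)
    (summable_wright_majorant hβ0 hβ1 (b := |1 - μ| + 1)
      (by have := abs_nonneg (1 - μ); linarith) |t|)
    (fun n => (tendsto_rpow_mul_binCoeff (μ - β * n)).const_mul _) ?_
  · rw [← wrightPhi_eq_tsum] at h
    refine h.congr' ?_
    filter_upwards [eventually_gt_atTop 0] with k hk
    have hk' : (0 : ℝ) < k := by exact_mod_cast hk
    rw [expCoeff, ← tsum_mul_left]
    refine tsum_congr fun n => ?_
    have : (k : ℝ) ^ (1 - (μ - β * n)) = (k : ℝ) ^ (1 - μ) * ((k : ℝ) ^ β) ^ n := by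
      rw [← Real.rpow_natCast, ← Real.rpow_mul hk'.le, ← Real.rpow_add hk']
      congr 1
      ring
    rw [this, neg_mul_eq_neg_mul, mul_pow]
    ring
  · filter_upwards [eventually_gt_atTop 0] with k hk n
    rw [norm_mul, norm_div, norm_pow, norm_neg, Real.norm_natCast, norm_mul, Real.norm_eq_abs,
      Real.norm_of_nonneg (by positivity : 0 ≤ (k : ℝ) ^ (1 - (μ - β * n))), Real.norm_eq_abs]
    exact mul_le_mul_of_nonneg_left (rpow_mul_abs_binCoeff_sub_le hβ0 μ n hk) (by positivity)

/-! ### Positivity and decay of the Wright function -/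

theorem wrightPhi_neg_nonneg {β : ℝ} (hβ0 : 0 ≤ β) (hβ1 : β < 1) {μ t : ℝ} (hμ : 0 ≤ μ)
    (ht : 0 ≤ t) : 0 ≤ wrightPhi (-β) μ (-t) :=
  ge_of_tendsto' (tendsto_rpow_mul_expCoeff hβ0 hβ1 μ t) fun _ =>
    mul_nonneg (by positivity) (expCoeff_nonneg hβ0 hβ1.le (by positivity) hμ _)

/-- Limit of the coefficient bound at `x = 1 - c/k`: `x^k → e^(-c)`, and the powers of `k` cancel.
-/
theorem wrightPhi_neg_le {β : ℝ} (hβ0 : 0 ≤ β) (hβ1 : β < 1) {μ t c : ℝ} (hμ : 1 ≤ μ)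
    (ht : 0 ≤ t) (hc : 0 < c) :
    wrightPhi (-β) μ (-t) ≤ c ^ (1 - μ) * Real.exp (c - t * c ^ β) := by
  have h1 : Tendsto (fun k : ℕ => (1 + -c / (k : ℝ)) ^ k) atTop (𝓝 (Real.exp (-c))) :=
    Real.tendsto_one_add_div_pow_exp (-c)
  have h2 : Tendsto (fun k : ℕ => ((1 + -c / (k : ℝ)) ^ k)⁻¹ *
      (c ^ (1 - μ) * Real.exp (-t * c ^ β))) atTop
      (𝓝 ((Real.exp (-c))⁻¹ * (c ^ (1 - μ) * Real.exp (-t * c ^ β)))) :=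
    (h1.inv₀ (Real.exp_ne_zero _)).mul_const _
  have h3 : (Real.exp (-c))⁻¹ * (c ^ (1 - μ) * Real.exp (-t * c ^ β)) =
      c ^ (1 - μ) * Real.exp (c - t * c ^ β) := by
    rw [← Real.exp_neg, neg_neg, mul_left_comm, ← Real.exp_add]
    congr 2
    ring
  rw [h3] at h2
  refine le_of_tendsto_of_tendsto (tendsto_rpow_mul_expCoeff hβ0 hβ1 μ t) h2 ?_
  filter_upwards [(tendsto_natCast_atTop_atTop (R := ℝ)).eventually_gt_atTop c] with k hk
  have hk' : 0 < (k : ℝ) := hc.trans hk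
  have hck : 0 < c / k := by positivity
  have hck1 : c / k < 1 := (div_lt_one hk').2 hk
  have hx : 0 < 1 + -c / (k : ℝ) := by rw [neg_div]; linarith
  have h := pow_mul_expCoeff_le hβ0 hβ1.le (l := t * (k : ℝ) ^ β) (by positivity) hμ hx.le
    (by rw [neg_div]; linarith) k
  rw [show 1 - (1 + -c / (k : ℝ)) = c / k by ring, Real.div_rpow hc.le hk'.le,
    Real.div_rpow hc.le hk'.le] at h
  have e : -(t * (k : ℝ) ^ β) * (c ^ β / (k : ℝ) ^ β) = -t * c ^ β := by
    field_simp
  rw [e] at h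
  have hkμ : 0 < (k : ℝ) ^ (1 - μ) := by positivity
  rw [inv_mul_eq_div, le_div_iff₀ (by positivity)]
  calc _ = (k : ℝ) ^ (1 - μ) *
        ((1 + -c / (k : ℝ)) ^ k * expCoeff β μ (t * (k : ℝ) ^ β) k) := by ring
    _ ≤ (k : ℝ) ^ (1 - μ) * (c ^ (1 - μ) / (k : ℝ) ^ (1 - μ) * Real.exp (-t * c ^ β)) := by gcongr
    _ = _ := by field_simp

/-- Apply `1/Γ(s) = s/Γ(s+1)` at `s = μ - βn`, valid also at the poles; the part carrying `-βn`
loses its term `n = 0` and reindexes. -/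
theorem wrightPhi_recurrence {β : ℝ} (hβ0 : 0 ≤ β) (hβ1 : β < 1) (μ t : ℝ) :
    wrightPhi (-β) μ (-t) =
      β * t * wrightPhi (-β) (μ + (1 - β)) (-t) + μ * wrightPhi (-β) (μ + 1) (-t) := by
  have hG : ∀ s : ℝ, (Real.Gamma s)⁻¹ = s * (Real.Gamma (s + 1))⁻¹ := by
    intro s
    rcases eq_or_ne s 0 with rfl | hs
    · simp [Real.Gamma_zero]
    · rw [Real.Gamma_add_one hs, mul_inv, mul_inv_cancel_left₀ hs]
  set d : ℕ → ℝ := fun n => (Real.Gamma (μ + 1 - β * n))⁻¹ with hd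
  have hterm : ∀ n : ℕ, (-t) ^ n / (n.factorial : ℝ) * (Real.Gamma (μ - β * n))⁻¹ =
      μ * ((-t) ^ n / (n.factorial : ℝ) * d n) +
        -(β * n) * ((-t) ^ n / (n.factorial : ℝ) * d n) := by
    intro n
    rw [hG, hd, show μ - β * n + 1 = μ + 1 - β * n by ring]
    ring
  have h1 : HasSum (fun n : ℕ => μ * ((-t) ^ n / (n.factorial : ℝ) * d n))
      (μ * wrightPhi (-β) (μ + 1) (-t)) := by
    rw [wrightPhi_eq_tsum]
    exact (summable_wrightPhi hβ0 hβ1 (μ + 1) (-t)).hasSum.mul_left μ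
  have h2 : HasSum (fun n : ℕ => -(β * n) * ((-t) ^ n / (n.factorial : ℝ) * d n))
      (β * t * wrightPhi (-β) (μ + (1 - β)) (-t)) := by
    rw [← hasSum_nat_add_iff' 1]
    simp only [Finset.sum_range_one, Nat.cast_zero, mul_zero, neg_zero, zero_mul, sub_zero]
    rw [wrightPhi_eq_tsum]
    have e : (fun n : ℕ => -(β * ((n + 1 : ℕ) : ℝ)) *
        ((-t) ^ (n + 1) / ((n + 1).factorial : ℝ) * d (n + 1))) =
        fun n : ℕ => β * t * ((-t) ^ n / (n.factorial : ℝ) *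
          (Real.Gamma (μ + (1 - β) - β * n))⁻¹) := by
      ext n
      rw [hd]
      dsimp only
      rw [show μ + 1 - β * ((n + 1 : ℕ) : ℝ) = μ + (1 - β) - β * n by push_cast; ring, pow_succ,
        Nat.factorial_succ]
      push_cast
      field_simp
    rw [e]
    exact (summable_wrightPhi hβ0 hβ1 (μ + (1 - β)) (-t)).hasSum.mul_left (β * t)
  rw [add_comm (β * t * _), wrightPhi_eq_tsum, ← (h1.add h2).tsum_eq]
  exact tsum_congr hterm

/-- Each use of the recurrence raises `μ` by at least `1-β` at the cost of a factor `1 + t`; `N`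
steps reach the range `μ ≥ 1`. -/
theorem wrightPhi_neg_le_pow_mul {β : ℝ} (hβ0 : 0 ≤ β) (hβ1 : β < 1) {t c : ℝ} (ht : 0 ≤ t)
    (hc : 1 ≤ c) (N : ℕ) {μ : ℝ} (hμ : 0 ≤ μ) (hN : 1 ≤ μ + N * (1 - β)) :
    wrightPhi (-β) μ (-t) ≤ (1 + t) ^ N * Real.exp (c - t * c ^ β) := by
  have hbig : ∀ {μ : ℝ}, 1 ≤ μ → wrightPhi (-β) μ (-t) ≤ Real.exp (c - t * c ^ β) := by
    intro μ hμ
    refine (wrightPhi_neg_le hβ0 hβ1 hμ ht (zero_lt_one.trans_le hc)).trans ?_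
    exact mul_le_of_le_one_left (Real.exp_pos _).le
      (Real.rpow_le_one_of_one_le_of_nonpos hc (by linarith))
  induction N generalizing μ with
  | zero =>
    rw [pow_zero, one_mul]
    exact hbig (by simpa using hN)
  | succ N ih =>
    have hone : 1 ≤ (1 + t) ^ N := one_le_pow₀ (by linarith)
    set D := Real.exp (c - t * c ^ β) with hD
    have hD0 : 0 < D := Real.exp_pos _
    rcases le_or_gt 1 μ with h1 | h1
    · refine (hbig h1).trans (le_mul_of_one_le_left hD0.le (one_le_pow₀ (by linarith)))
    · rw [wrightPhi_recurrence hβ0 hβ1]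
      have ha := ih (μ := μ + (1 - β)) (by linarith) (by push_cast at hN; linarith)
      have hb := hbig (μ := μ + 1) (by linarith)
      have hβt : β * t ≤ t := mul_le_of_le_one_left ht hβ1.le
      calc _ ≤ t * ((1 + t) ^ N * D) + 1 * D := by
            refine add_le_add (mul_le_mul hβt ha ?_ ht) (mul_le_mul h1.le hb ?_ zero_le_one)
            · exact wrightPhi_neg_nonneg hβ0 hβ1 (by linarith) ht
            · exact wrightPhi_neg_nonneg hβ0 hβ1 (by linarith) ht
        _ ≤ t * ((1 + t) ^ N * D) + (1 + t) ^ N * D := by gcongr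
        _ = _ := by ring

theorem wrightPhi_neg_le_rpow_mul_exp {β : ℝ} (hβ0 : 0 < β) (hβ1 : β < 1) {μ t : ℝ}
    (hμ : 1 - β ≤ μ) (ht : 1 ≤ β * t) :
    wrightPhi (-β) μ (-t) ≤ (1 + t) ^ (1 / (1 - β)) *
      Real.exp (-((1 - β) * (β * t) ^ (1 / (1 - β)))) := by
  have hβ' : 0 < 1 - β := by linarith
  set p : ℝ := 1 / (1 - β) with hp
  have hp1 : p * (1 - β) = 1 := by rw [hp]; field_simp
  have ht0 : 0 < t := by
    by_contra h
    nlinarith [not_lt.1 h]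
  have hp0 : 0 < p := by positivity
  -- The minimizer of `c - t c^β`, where `t c^β = c/β`. Below, `N = ⌈βp⌉` steps suffice, and `N ≤ βp
  -- + 1 = p`.
  set c : ℝ := (β * t) ^ p with hc
  have hc1 : 1 ≤ c := Real.one_le_rpow ht hp0.le
  have hcβ : t * c ^ β = c / β := by
    have : c ^ β = (β * t) ^ p / (β * t) := by
      rw [hc, ← Real.rpow_mul (by linarith), show p * β = p - 1 by linarith,
        Real.rpow_sub (by linarith), Real.rpow_one]
    rw [this, ← hc]
    field_simp
  have hN1 : β * p ≤ (⌈β * p⌉₊ : ℝ) := Nat.le_ceil _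
  have hN2 : (⌈β * p⌉₊ : ℝ) < β * p + 1 := Nat.ceil_lt_add_one (by positivity)
  refine (wrightPhi_neg_le_pow_mul hβ0.le hβ1 ht0.le hc1 ⌈β * p⌉₊ (by linarith) ?_).trans ?_
  · have : β * p * (1 - β) ≤ (⌈β * p⌉₊ : ℝ) * (1 - β) := by gcongr
    have e : β * p * (1 - β) = β := by rw [mul_assoc, hp1, mul_one]
    linarith
  · gcongr
    · rw [← Real.rpow_natCast]
      exact Real.rpow_le_rpow_of_exponent_le (by linarith) (by linarith)
    · rw [hcβ]
      have : 1 / β - 1 ≥ 1 - β := by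
        have : 1 / β - 1 - (1 - β) = (1 - β) ^ 2 / β := by field_simp
        have h2 : 0 ≤ (1 - β) ^ 2 / β := by positivity
        linarith
      have e : c - c / β = -((1 / β - 1) * c) := by ring
      rw [e]
      nlinarith

/-! ### Derivative in `z` and total mass -/

theorem hasDerivAt_wrightPhi {β : ℝ} (hβ0 : 0 ≤ β) (hβ1 : β < 1) (μ z : ℝ) :
    HasDerivAt (fun z => wrightPhi (-β) μ z) (wrightPhi (-β) (μ - β) z) z := by
  set c : ℕ → ℝ := fun n => (Real.Gamma (μ - β * n))⁻¹ with hc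
  have hcs : ∀ n : ℕ, c (n + 1) = (Real.Gamma (μ - β - β * n))⁻¹ := by
    intro n
    rw [hc]
    dsimp only
    rw [show μ - β * ((n + 1 : ℕ) : ℝ) = μ - β - β * n by push_cast; ring]
  have hshift : ∀ (n : ℕ) (w : ℝ),
      ((n + 1 : ℕ) : ℝ) * w ^ (n + 1 - 1) / ((n + 1).factorial : ℝ) = w ^ n / (n.factorial : ℝ) := by
    intro n w
    rw [Nat.factorial_succ, Nat.add_sub_cancel]
    push_cast
    field_simp
  set R : ℝ := |z| + 1 with hR
  have hR0 : 0 < R := by positivity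
  have hu : Summable fun n : ℕ => (n : ℝ) * R ^ (n - 1) / (n.factorial : ℝ) * |c n| := by
    rw [← summable_nat_add_iff 1]
    refine (summable_abs_wrightPhi hβ0 hβ1 (μ - β) R).congr fun n => ?_
    rw [hshift, hcs, abs_of_pos hR0]
  have h := hasDerivAt_tsum_of_isPreconnected (t := Metric.ball (0 : ℝ) R)
    (g := fun (n : ℕ) w => w ^ n / (n.factorial : ℝ) * c n)
    (g' := fun (n : ℕ) w => (n : ℝ) * w ^ (n - 1) / (n.factorial : ℝ) * c n) (y₀ := 0) (y := z)
    hu Metric.isOpen_ball (convex_ball 0 R).isPreconnected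
    (fun n y _ => ((hasDerivAt_pow n y).div_const _).mul_const _) ?_ (Metric.mem_ball_self hR0)
    (summable_wrightPhi hβ0 hβ1 μ 0) (by simp [hR])
  · have e : (fun z => wrightPhi (-β) μ z) = fun w => ∑' n : ℕ, w ^ n / (n.factorial : ℝ) * c n :=
      funext fun w => wrightPhi_eq_tsum β μ w
    rw [e]
    convert! h using 1
    have hs : Summable fun n : ℕ => (n : ℝ) * z ^ (n - 1) / (n.factorial : ℝ) * c n := by
      rw [← summable_nat_add_iff 1]
      refine (summable_wrightPhi hβ0 hβ1 (μ - β) z).congr fun n => ?_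
      rw [hshift, hcs]
    rw [hs.tsum_eq_zero_add, wrightPhi_eq_tsum]
    simp only [Nat.cast_zero, zero_mul, zero_div, zero_add]
    refine tsum_congr fun n => ?_
    rw [hshift, hcs]
  · intro n y hy
    have hy' : |y| ≤ R := by
      have := Metric.mem_ball.1 hy
      rw [dist_zero_right] at this
      exact this.le
    rw [norm_mul, norm_div, norm_mul, norm_pow, Real.norm_natCast, Real.norm_natCast,
      Real.norm_eq_abs, Real.norm_eq_abs]
    gcongr

theorem continuous_wrightPhi_neg {β : ℝ} (hβ0 : 0 ≤ β) (hβ1 : β < 1) (μ : ℝ) :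
    Continuous fun t => wrightPhi (-β) μ (-t) := by
  have : Continuous fun z => wrightPhi (-β) μ z :=
    continuous_iff_continuousAt.2 fun z => (hasDerivAt_wrightPhi hβ0 hβ1 μ z).continuousAt
  exact this.comp continuous_neg

theorem wrightPhi_one_zero (β : ℝ) : wrightPhi (-β) 1 0 = 1 := by
  rw [wrightPhi_eq_tsum, tsum_eq_single 0]
  · simp
  · intro n hn
    simp [hn]

theorem integral_wrightPhi_neg {β : ℝ} (hβ0 : 0 ≤ β) (hβ1 : β < 1) (T : ℝ) :
    ∫ t in (0 : ℝ)..T, wrightPhi (-β) (1 - β) (-t) = 1 - wrightPhi (-β) 1 (-T) := by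
  have hd : ∀ t ∈ uIcc 0 T, HasDerivAt (fun t => -wrightPhi (-β) 1 (-t))
      (wrightPhi (-β) (1 - β) (-t)) t := by
    intro t _
    have := ((hasDerivAt_wrightPhi hβ0 hβ1 1 (-t)).comp t (hasDerivAt_neg t)).neg
    rw [mul_neg_one, neg_neg] at this
    exact this
  rw [intervalIntegral.integral_eq_sub_of_hasDerivAt hd
    ((continuous_wrightPhi_neg hβ0 hβ1 _).intervalIntegrable _ _)]
  rw [neg_zero, wrightPhi_one_zero]
  ring

/-! ### Smallness to the left of `1` -/

theorem inv_Gamma_one_sub {y : ℝ} (hy : 0 < y) :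
    (Real.Gamma (1 - y))⁻¹ * Real.pi = Real.Gamma y * Real.sin (Real.pi * y) := by
  have h := Real.Gamma_mul_Gamma_one_sub y
  have hy0 : Real.Gamma y ≠ 0 := (Real.Gamma_pos_of_pos hy).ne'
  by_cases h0 : Real.Gamma (1 - y) = 0
  · rw [h0, mul_zero, eq_comm, div_eq_zero_iff] at h
    rw [h0, h.resolve_left Real.pi_ne_zero]
    simp
  · have hs : Real.sin (Real.pi * y) ≠ 0 := by
      intro hs
      rw [hs, div_zero] at h
      exact (mul_ne_zero hy0 h0) h
    rw [eq_div_iff hs] at h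
    rw [inv_mul_eq_div, div_eq_iff h0]
    linear_combination -h

/-- Log-convexity of `Γ` between `1` and `n + 2`, with weights `1-β` and `β`. -/
theorem Gamma_mul_succ_le {β : ℝ} (hβ0 : 0 < β) (hβ1 : β < 1) (n : ℕ) :
    Real.Gamma (β * (n + 1)) ≤ (n.factorial : ℝ) / β := by
  have hn : (0 : ℝ) < n + 1 := by positivity
  have h := Real.Gamma_mul_add_mul_le_rpow_Gamma_mul_rpow_Gamma (s := (n : ℝ) + 1 + 1) (t := 1)
    (a := β) (b := 1 - β) (by positivity) one_pos hβ0 (by linarith) (by ring)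
  rw [Real.Gamma_one, Real.one_rpow, mul_one, mul_one,
    show β * ((n : ℝ) + 1 + 1) + (1 - β) = β * (n + 1) + 1 by ring,
    Real.Gamma_add_one (by positivity)] at h
  have hf : Real.Gamma ((n : ℝ) + 1 + 1) = ((n + 1).factorial : ℝ) := by
    have := Real.Gamma_nat_eq_factorial (n + 1)
    push_cast at this
    exact this
  rw [hf] at h
  have h1 : ((n + 1).factorial : ℝ) ^ β ≤ (n + 1).factorial := by
    conv_rhs => rw [← Real.rpow_one ((n + 1).factorial : ℝ)]
    exact Real.rpow_le_rpow_of_exponent_le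
      (by exact_mod_cast Nat.one_le_iff_ne_zero.2 (Nat.factorial_ne_zero _)) hβ1.le
  have h2 := h.trans h1
  rw [Nat.factorial_succ] at h2
  push_cast at h2
  rw [le_div_iff₀ hβ0]
  have h3 : (n + 1 : ℝ) * (Real.Gamma (β * (n + 1)) * β) ≤ (n + 1) * (n.factorial : ℝ) := by
    calc _ = β * (n + 1) * Real.Gamma (β * (n + 1)) := by ring
      _ ≤ _ := h2
  exact le_of_mul_le_mul_left h3 hn

/-- By reflection, `π/Γ(1 - β(n+1)) = Γ(β(n+1)) sin(πβ(n+1))`. The sine is within `π(1-β)(n+1)` of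
zero because `β(n+1)` is that close, up to the factor `π`, to an integer. -/
theorem wrightPhi_neg_le_of_le {β : ℝ} (hβ0 : 0 < β) (hβ1 : β < 1) {t T : ℝ} (ht : 0 ≤ t)
    (htT : t ≤ T) (hT : T < 1) :
    wrightPhi (-β) (1 - β) (-t) ≤ (1 - β) / β * ∑' n : ℕ, ((n : ℝ) + 1) * T ^ n := by
  have hT0 : 0 ≤ T := ht.trans htT
  have hsum : Summable fun n : ℕ => ((n : ℝ) + 1) * T ^ n := by
    have h1 := summable_pow_mul_geometric_of_norm_lt_one 1 (r := T)
      (by rwa [Real.norm_of_nonneg hT0])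
    have h2 := summable_geometric_of_lt_one hT0 hT
    refine (h1.add h2).congr fun n => ?_
    ring
  rw [wrightPhi_eq_tsum, ← tsum_mul_left]
  refine (summable_wrightPhi hβ0.le hβ1 _ _).tsum_le_tsum (fun n => ?_) (hsum.mul_left _)
  have hn : (0 : ℝ) < n + 1 := by positivity
  have hΓ : |(Real.Gamma (1 - β - β * n))⁻¹| ≤ (n.factorial : ℝ) / β * ((1 - β) * (n + 1)) := by
    have h := inv_Gamma_one_sub (y := β * (n + 1)) (by positivity)
    rw [show 1 - β * ((n : ℝ) + 1) = 1 - β - β * n by ring] at h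
    have hsin : |Real.sin (Real.pi * (β * (n + 1)))| ≤ Real.pi * ((1 - β) * (n + 1)) := by
      have e : Real.pi * (β * ((n : ℝ) + 1)) =
          ((n + 1 : ℕ) : ℝ) * Real.pi - Real.pi * ((1 - β) * (n + 1)) := by push_cast; ring
      rw [e, Real.sin_nat_mul_pi_sub]
      rw [abs_neg, abs_mul, abs_pow, abs_neg, abs_one, one_pow, one_mul]
      refine Real.abs_sin_le_abs.trans ?_
      rw [abs_of_nonneg]
      have : 0 ≤ 1 - β := by linarith
      have := Real.pi_pos
      positivity
    have hG0 : 0 < Real.Gamma (β * (n + 1)) := Real.Gamma_pos_of_pos (by positivity)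
    have h2 : |(Real.Gamma (1 - β - β * n))⁻¹| * Real.pi ≤
        (n.factorial : ℝ) / β * ((1 - β) * (n + 1)) * Real.pi := by
      calc |(Real.Gamma (1 - β - β * n))⁻¹| * Real.pi
          = |(Real.Gamma (1 - β - β * n))⁻¹ * Real.pi| := by
            rw [abs_mul, abs_of_pos Real.pi_pos]
        _ = Real.Gamma (β * (n + 1)) * |Real.sin (Real.pi * (β * (n + 1)))| := by
            rw [h, abs_mul, abs_of_pos hG0]
        _ ≤ (n.factorial : ℝ) / β * (Real.pi * ((1 - β) * (n + 1))) :=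
            mul_le_mul (Gamma_mul_succ_le hβ0 hβ1 n) hsin (abs_nonneg _) (by positivity)
        _ = _ := by ring
    exact le_of_mul_le_mul_right h2 Real.pi_pos
  refine (le_abs_self _).trans ?_
  rw [abs_mul, abs_div, abs_pow, abs_neg, abs_of_nonneg ht, Nat.abs_cast]
  calc _ ≤ T ^ n / (n.factorial : ℝ) * ((n.factorial : ℝ) / β * ((1 - β) * (n + 1))) := by gcongr
    _ = _ := by field_simp

/-! ### Absolute convergence -/

theorem eventually_mul_rpow_le_mul_rpow {q p : ℝ} (hqp : q < p) (C : ℝ) {c : ℝ} (hc : 0 < c) :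
    ∀ᶠ t : ℝ in atTop, C * t ^ q ≤ c * t ^ p := by
  have h : Tendsto (fun t : ℝ => C * t ^ (-(p - q))) atTop (𝓝 (C * 0)) :=
    (tendsto_rpow_neg_atTop (by linarith)).const_mul C
  rw [mul_zero] at h
  filter_upwards [h.eventually (ge_mem_nhds hc), eventually_gt_atTop 0] with t ht ht0
  have e : t ^ q = t ^ (-(p - q)) * t ^ p := by
    rw [← Real.rpow_add ht0]
    congr 1
    ring
  rw [e, ← mul_assoc]
  exact mul_le_mul_of_nonneg_right ht (by positivity)

theorem one_add_rpow_le_exp {t p : ℝ} (ht : 0 ≤ t) (hp : 0 ≤ p) :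
    (1 + t) ^ p ≤ Real.exp (p * t) := by
  rw [mul_comm, Real.exp_mul]
  refine Real.rpow_le_rpow (by linarith) ?_ hp
  rw [add_comm]
  exact Real.add_one_le_exp t

theorem integrableOn_Ioi_mul_of_eventually_le {𝕜 : Type*} [RCLike 𝕜] {g : ℝ → 𝕜} {σ δ : ℝ}
    (hint : ∀ T : ℝ, 0 < T → IntegrableOn g (Ioc 0 T) volume)
    (hgrowth : g =O[atTop] fun t : ℝ => Real.exp (σ * t ^ δ)) {φ : ℝ → ℝ} (hφ : Continuous φ)
    (hdecay : ∀ᶠ t in atTop, Real.exp (σ * t ^ δ) * |φ t| ≤ Real.exp (-t)) :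
    IntegrableOn (fun t => g t * ((φ t : ℝ) : 𝕜)) (Ioi 0) volume := by
  have hφ' : Continuous fun t => ((φ t : ℝ) : 𝕜) := RCLike.continuous_ofReal.comp hφ
  have hloc : LocallyIntegrableOn (fun t => g t * ((φ t : ℝ) : 𝕜)) (Ici 0) volume := by
    rw [locallyIntegrableOn_iff isClosed_Ici.isLocallyClosed]
    intro k hk hkc
    obtain ⟨T, hT⟩ := hkc.bddAbove
    have hsub : k ⊆ Icc 0 (max T 1) := fun x hx => ⟨hk hx, (hT hx).trans (le_max_left _ _)⟩
    refine IntegrableOn.mono_set ?_ hsub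
    refine IntegrableOn.mul_continuousOn ?_ hφ'.continuousOn isCompact_Icc
    rw [integrableOn_Icc_iff_integrableOn_Ioc]
    exact hint _ (by positivity)
  refine (hloc.integrableOn_of_isBigO_atTop (g := fun t => Real.exp (-t)) ?_
    ⟨Ioi 0, Ioi_mem_atTop 0, integrableOn_exp_neg_Ioi 0⟩).mono_set Ioi_subset_Ici_self
  have h1 : (fun t => ((φ t : ℝ) : 𝕜)) =O[atTop] φ :=
    IsBigO.of_bound 1 (Eventually.of_forall fun t => by simp)
  refine (hgrowth.mul h1).trans (IsBigO.of_bound 1 ?_)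
  filter_upwards [hdecay] with t ht
  rw [one_mul, norm_mul, Real.norm_of_nonneg (Real.exp_pos _).le,
    Real.norm_of_nonneg (Real.exp_pos _).le, Real.norm_eq_abs]
  exact ht

theorem eventually_exp_mul_wrightPhi_le {β δ : ℝ} (hβ0 : 0 < β) (hβ1 : β < 1)
    (hδ : δ < 1 / (1 - β)) (σ : ℝ) :
    ∀ᶠ t in atTop, Real.exp (σ * t ^ δ) * |wrightPhi (-β) (1 - β) (-t)| ≤ Real.exp (-t) := by
  have hβ' : 0 < 1 - β := by linarith
  set p : ℝ := 1 / (1 - β) with hp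
  have hp0 : 0 < p := by positivity
  have hp1 : 1 < p := by rw [hp, lt_div_iff₀ hβ']; linarith
  -- Half of the decay rate absorbs `σ t^δ`, the other half `(p + 1) t`: the power of `1 + t` plus
  -- the spare `exp(-t)`.
  have hκ : 0 < (1 - β) * β ^ p / 2 := by positivity
  filter_upwards [eventually_mul_rpow_le_mul_rpow hδ σ hκ,
    eventually_mul_rpow_le_mul_rpow hp1 (p + 1) hκ, eventually_ge_atTop (1 / β),
    eventually_gt_atTop 0] with t h1 h2 h3 ht
  rw [Real.rpow_one] at h2
  rw [div_le_iff₀' hβ0] at h3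
  rw [abs_of_nonneg (wrightPhi_neg_nonneg hβ0.le hβ1 hβ'.le ht.le)]
  have h4 := wrightPhi_neg_le_rpow_mul_exp hβ0 hβ1 le_rfl h3
  rw [← hp, Real.mul_rpow hβ0.le ht.le] at h4
  calc _ ≤ Real.exp (σ * t ^ δ) * (Real.exp (p * t) *
        Real.exp (-((1 - β) * (β ^ p * t ^ p)))) := by
        gcongr
        refine h4.trans ?_
        gcongr
        exact one_add_rpow_le_exp ht.le hp0.le
    _ = Real.exp (σ * t ^ δ + (p * t + -((1 - β) * (β ^ p * t ^ p)))) := by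
        rw [Real.exp_add, Real.exp_add]
    _ ≤ _ := Real.exp_le_exp.2 (by linarith)

/-! ### Concentration at `1` as `β → 1⁻` -/

theorem tendsto_one_div_one_sub_atTop :
    Tendsto (fun β : ℝ => 1 / (1 - β)) (𝓝[<] 1) atTop := by
  simp_rw [one_div]
  refine tendsto_inv_nhdsGT_zero.comp (tendsto_nhdsWithin_iff.2 ⟨?_, ?_⟩)
  · have : Tendsto (fun β : ℝ => 1 - β) (𝓝 1) (𝓝 (1 - 1)) :=
      (continuous_const.sub continuous_id).tendsto 1
    rw [sub_self] at this
    exact this.mono_left nhdsWithin_le_nhds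
  · filter_upwards [self_mem_nhdsWithin] with β hβ
    simpa using hβ

theorem eventually_mem_Ioo_nhdsLT_one : ∀ᶠ β : ℝ in 𝓝[<] 1, 0 < β ∧ β < 1 := by
  filter_upwards [Ioo_mem_nhdsLT (zero_lt_one (α := ℝ))] with β hβ using hβ

/-- Beyond the point `1`, the functions `t ↦ φ(-β, μ; -t)` decay faster than any `exp (-A * t ^ K)`
as `β` tends to `1` from the left. -/
theorem eventually_wrightPhi_neg_le_exp {a : ℝ} (ha : 1 < a) {A : ℝ} (hA : 0 ≤ A) (K : ℝ) :
    ∀ᶠ β : ℝ in 𝓝[<] 1, ∀ μ, 1 - β ≤ μ → ∀ t, a ≤ t →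
      wrightPhi (-β) μ (-t) ≤ Real.exp (-(A * t ^ K)) := by
  set k : ℝ := max K 1 with hk
  have hk0 : 0 < k := zero_lt_one.trans_le (le_max_right _ _)
  have hloga : 0 < Real.log a / 2 := half_pos (Real.log_pos ha)
  have ha0 : 0 < a := zero_lt_one.trans ha
  -- As `a > 1`, `a^(p/2)` is exponential in `p` and beats the polynomial; because `p/2 ≥ k`, the
  -- inequality at `a` propagates to all `t ≥ a`.
  have hexp : ∀ᶠ p : ℝ in atTop, p * (p + A) * a ^ k ≤ a ^ (p / 2) := by
    have hc : 0 < 1 / (2 * a ^ k) := by positivity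
    filter_upwards [(isLittleO_pow_exp_pos_mul_atTop 2 hloga).bound hc, eventually_ge_atTop A,
      eventually_gt_atTop 0] with p h1 h2 h3
    rw [Real.norm_of_nonneg (by positivity), Real.norm_of_nonneg (Real.exp_pos _).le,
      div_mul_eq_mul_div, one_mul, le_div_iff₀ (by positivity)] at h1
    have e : a ^ (p / 2) = Real.exp (Real.log a / 2 * p) := by
      rw [Real.rpow_def_of_pos ha0]
      congr 1
      ring
    rw [e]
    refine le_trans ?_ h1
    have : 0 < a ^ k := by positivity
    have h4 : p * (p + A) ≤ p ^ 2 * 2 := by nlinarith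
    calc _ ≤ p ^ 2 * 2 * a ^ k := by gcongr
      _ = _ := by ring
  have hβa : ∀ᶠ β : ℝ in 𝓝[<] 1, 1 ≤ β ^ 2 * a := by
    have : Tendsto (fun β : ℝ => β ^ 2 * a) (𝓝 1) (𝓝 (1 ^ 2 * a)) :=
      ((continuous_id.pow 2).mul continuous_const).tendsto 1
    exact (this.mono_left nhdsWithin_le_nhds).eventually (le_mem_nhds (by linarith))
  filter_upwards [tendsto_one_div_one_sub_atTop.eventually hexp,
    tendsto_one_div_one_sub_atTop.eventually (eventually_ge_atTop (2 * k)), hβa,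
    eventually_mem_Ioo_nhdsLT_one] with β h1 h2 h3 hβ μ hμ t ht
  obtain ⟨hβ0, hβ1⟩ := hβ
  have hβ' : 0 < 1 - β := by linarith
  have hp' : 1 - β = 1 / (1 / (1 - β)) := by rw [one_div_one_div]
  have hbd := fun h => wrightPhi_neg_le_rpow_mul_exp hβ0 hβ1 hμ (t := t) h
  have hp0 : 0 < 1 / (1 - β) := by positivity
  set p : ℝ := 1 / (1 - β) with hp
  have ht1 : 1 ≤ t := ha.le.trans ht
  have ht0 : 0 < t := by linarith
  -- This trades `(βt)^p` for `t^(p/2)`, removing `β` from the base uniformly in `t ≥ a`.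
  have hsq : t ≤ (β * t) ^ 2 := by
    have : 1 ≤ β ^ 2 * t := h3.trans (by gcongr)
    nlinarith
  have hβt : 1 ≤ β * t := by
    have : 0 ≤ β * t := by positivity
    nlinarith
  have hpow : t ^ (p / 2) ≤ (β * t) ^ p := by
    calc t ^ (p / 2) ≤ ((β * t) ^ 2) ^ (p / 2) := by gcongr
      _ = (β * t) ^ p := by
        rw [← Real.rpow_natCast, ← Real.rpow_mul (by positivity)]
        congr 1
        push_cast
        ring
  have hmain : p * (p + A) * t ^ k ≤ t ^ (p / 2) := by
    have e : ∀ x : ℝ, 0 < x → x ^ (p / 2) = x ^ (p / 2 - k) * x ^ k := by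
      intro x hx
      rw [← Real.rpow_add hx, sub_add_cancel]
    rw [e a ha0] at h1
    have h5 : p * (p + A) ≤ a ^ (p / 2 - k) := le_of_mul_le_mul_right h1 (by positivity)
    rw [e t ht0]
    have h6 : a ^ (p / 2 - k) ≤ t ^ (p / 2 - k) :=
      Real.rpow_le_rpow ha0.le ht (by linarith)
    exact mul_le_mul_of_nonneg_right (h5.trans h6) (by positivity)
  have htk : t ≤ t ^ k := by
    conv_lhs => rw [← Real.rpow_one t]
    exact Real.rpow_le_rpow_of_exponent_le ht1 (le_max_right _ _)
  have htK : t ^ K ≤ t ^ k := Real.rpow_le_rpow_of_exponent_le ht1 (le_max_left _ _)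
  have hfin : p * t + A * t ^ K ≤ (1 - β) * (β * t) ^ p := by
    have h7 : (p + A) * t ^ k ≤ (1 - β) * (β * t) ^ p := by
      rw [hp', div_mul_eq_mul_div, one_mul, le_div_iff₀ hp0]
      linarith
    have h8 : p * t ≤ p * t ^ k := by gcongr
    have h9 : A * t ^ K ≤ A * t ^ k := by gcongr
    linarith
  refine (hbd hβt).trans ?_
  calc _ ≤ Real.exp (p * t) * Real.exp (-((1 - β) * (β * t) ^ p)) := by
        gcongr
        exact one_add_rpow_le_exp ht0.le hp0.le
    _ = Real.exp (p * t + -((1 - β) * (β * t) ^ p)) := by rw [Real.exp_add]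
    _ ≤ _ := Real.exp_le_exp.2 (by linarith)

theorem exists_exp_neg_mul_lt (I : ℝ) {ε : ℝ} (hε : 0 < ε) :
    ∃ A : ℝ, 0 ≤ A ∧ Real.exp (-A) * I < ε := by
  have h : Tendsto (fun A : ℝ => Real.exp (-A) * I) atTop (𝓝 (0 * I)) :=
    Real.tendsto_exp_neg_atTop_nhds_zero.mul_const I
  rw [zero_mul] at h
  obtain ⟨A, hA⟩ := ((h.eventually (gt_mem_nhds hε)).and (eventually_ge_atTop 0)).exists
  exact ⟨A, hA.2, hA.1⟩

theorem tendsto_integral_wrightPhi_Ioc :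
    Tendsto (fun β : ℝ => ∫ t in Ioc (0 : ℝ) 2, wrightPhi (-β) (1 - β) (-t)) (𝓝[<] 1) (𝓝 1) := by
  have h : Tendsto (fun β : ℝ => wrightPhi (-β) 1 (-2)) (𝓝[<] 1) (𝓝 0) := by
    refine Metric.tendsto_nhds.2 fun ε hε => ?_
    obtain ⟨A, hA0, hA⟩ := exists_exp_neg_mul_lt 1 hε
    filter_upwards [eventually_wrightPhi_neg_le_exp one_lt_two hA0 0,
      eventually_mem_Ioo_nhdsLT_one] with β h1 hβ
    have h2 := h1 1 (by linarith [hβ.1]) 2 le_rfl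
    rw [Real.rpow_zero, mul_one] at h2
    rw [mul_one] at hA
    rw [Real.dist_0_eq_abs,
      abs_of_nonneg (wrightPhi_neg_nonneg hβ.1.le hβ.2 zero_le_one zero_le_two)]
    exact h2.trans_lt hA
  have h' := h.const_sub 1
  rw [sub_zero] at h'
  refine h'.congr' ?_
  filter_upwards [eventually_mem_Ioo_nhdsLT_one] with β hβ
  rw [← integral_wrightPhi_neg hβ.1.le hβ.2, intervalIntegral.integral_of_le zero_le_two]

theorem tendstoUniformlyOn_wrightPhi {u : Set ℝ} (hu : IsOpen u) (h1u : 1 ∈ u) :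
    TendstoUniformlyOn (fun β t => wrightPhi (-β) (1 - β) (-t)) 0 (𝓝[<] 1) (Ioc 0 2 \ u) := by
  obtain ⟨r, hr0, hr⟩ := Metric.isOpen_iff.1 hu 1 h1u
  set T : ℝ := 1 - r with hT
  refine Metric.tendstoUniformlyOn_iff.2 fun ε hε => ?_
  obtain ⟨A, hA0, hA⟩ := exists_exp_neg_mul_lt 1 hε
  have hleft : Tendsto (fun β : ℝ => (1 - β) / β * ∑' n : ℕ, ((n : ℝ) + 1) * T ^ n) (𝓝[<] 1)
      (𝓝 ((1 - 1) / 1 * ∑' n : ℕ, ((n : ℝ) + 1) * T ^ n)) := by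
    have h : Tendsto (fun β : ℝ => β) (𝓝[<] 1) (𝓝 1) :=
      tendsto_id.mono_left nhdsWithin_le_nhds
    exact ((h.const_sub 1).div h one_ne_zero).mul_const _
  rw [sub_self, zero_div, zero_mul] at hleft
  -- The exponent `K = 0` turns the decay estimate into the constant bound `e^(-A) < ε` to the right
  -- of `1`.
  filter_upwards [eventually_wrightPhi_neg_le_exp (by linarith : 1 < 1 + r) hA0 0,
    hleft.eventually (gt_mem_nhds hε), eventually_mem_Ioo_nhdsLT_one] with β h1 h2 hβ t ht
  have ht0 : 0 ≤ t := ht.1.1.le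
  rw [Pi.zero_apply, dist_comm, Real.dist_0_eq_abs,
    abs_of_nonneg (wrightPhi_neg_nonneg hβ.1.le hβ.2 (by linarith [hβ.2]) ht0)]
  have hdist : r ≤ |t - 1| := by
    by_contra hlt
    exact ht.2 (hr (by rw [Metric.mem_ball, Real.dist_eq]; exact not_le.1 hlt))
  rcases le_abs.1 hdist with h | h
  · have h3 := h1 (1 - β) le_rfl t (by linarith)
    rw [Real.rpow_zero, mul_one] at h3
    rw [mul_one] at hA
    exact h3.trans_lt hA
  · exact (wrightPhi_neg_le_of_le hβ.1 hβ.2 ht0 (by linarith : t ≤ T) (by linarith)).trans_lt h2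

/-! ### The tail and the limit -/

theorem tendsto_setIntegral_Ioi_mul_wrightPhi {𝕜 : Type*} [RCLike 𝕜] {g : ℝ → 𝕜} {σ δ : ℝ}
    (hint : ∀ T : ℝ, 0 < T → IntegrableOn g (Ioc 0 T) volume) (hσ : 0 < σ)
    (hgrowth : g =O[atTop] fun t : ℝ => Real.exp (σ * t ^ δ)) :
    Tendsto (fun β : ℝ => ∫ t in Ioi (2 : ℝ), g t * ((wrightPhi (-β) (1 - β) (-t) : ℝ) : 𝕜))
      (𝓝[<] 1) (𝓝 0) := by
  set K : ℝ := max δ 1 with hK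
  have hK0 : 0 ≤ K := zero_le_one.trans (le_max_right _ _)
  -- In `σ + 1`, the `σ` offsets the growth of `g` and the `1` leaves `exp(-t)`. An extra rate `A`
  -- then yields a factor `e^(-A)`, since `t^K ≥ 1` for `t > 2`.
  set w : ℝ → ℝ := fun t => Real.exp (-((σ + 1) * t ^ K)) with hw
  have hwc : Continuous w :=
    (continuous_const.mul (continuous_id.rpow_const fun _ => Or.inr hK0)).neg.rexp
  have hgw : IntegrableOn (fun t => g t * ((w t : ℝ) : 𝕜)) (Ioi 2) volume := by
    refine (integrableOn_Ioi_mul_of_eventually_le hint hgrowth hwc ?_).mono_set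
      (Ioi_subset_Ioi zero_le_two)
    filter_upwards [eventually_ge_atTop 1] with t ht
    rw [abs_of_pos (Real.exp_pos _), ← Real.exp_add, Real.exp_le_exp]
    have h1 : t ^ δ ≤ t ^ K := Real.rpow_le_rpow_of_exponent_le ht (le_max_left _ _)
    have h2 : t ≤ t ^ K := by
      conv_lhs => rw [← Real.rpow_one t]
      exact Real.rpow_le_rpow_of_exponent_le ht (le_max_right _ _)
    nlinarith
  set I : ℝ := ∫ t in Ioi (2 : ℝ), ‖g t * ((w t : ℝ) : 𝕜)‖ with hI
  refine Metric.tendsto_nhds.2 fun ε hε => ?_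
  obtain ⟨A, hA0, hA⟩ := exists_exp_neg_mul_lt I hε
  filter_upwards [eventually_wrightPhi_neg_le_exp one_lt_two (by linarith : 0 ≤ A + (σ + 1)) K,
    eventually_mem_Ioo_nhdsLT_one] with β h1 hβ
  rw [dist_zero_right]
  refine lt_of_le_of_lt ?_ hA
  rw [hI, ← integral_const_mul]
  refine norm_integral_le_of_norm_le (hgw.norm.const_mul _) ?_
  refine (ae_restrict_iff' measurableSet_Ioi).2 (Eventually.of_forall fun t ht => ?_)
  have ht2 : (2 : ℝ) < t := ht
  have hM := h1 (1 - β) le_rfl t ht2.le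
  have hM0 := wrightPhi_neg_nonneg hβ.1.le hβ.2 (by linarith [hβ.2] : 0 ≤ 1 - β)
    (by linarith : 0 ≤ t)
  have htK : 1 ≤ t ^ K := Real.one_le_rpow (by linarith) hK0
  rw [norm_mul, norm_mul, RCLike.norm_ofReal, RCLike.norm_ofReal, abs_of_nonneg hM0,
    abs_of_pos (Real.exp_pos _), mul_left_comm, ← Real.exp_add]
  refine mul_le_mul_of_nonneg_left (hM.trans (Real.exp_le_exp.2 ?_)) (norm_nonneg _)
  nlinarith

theorem lemma4p2 {𝕜 : Type*} [RCLike 𝕜] (g : ℝ → 𝕜)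
    (hint : ∀ T : ℝ, 0 < T → IntegrableOn g (Ioc 0 T) volume)
    (hcont : ContinuousAt g 1)
    (σ δ : ℝ) (hσ : 0 < σ)
    (hgrowth : g =O[atTop] fun t : ℝ => Real.exp (σ * t ^ δ)) :
    (∀ β : ℝ, 0 < β → β < 1 → δ < 1 / (1 - β) →
      IntegrableOn (fun t : ℝ => g t * ((wrightPhi (-β) (1 - β) (-t) : ℝ) : 𝕜)) (Ioi 0) volume) ∧
    Tendsto (fun β : ℝ => ∫ t in Ioi (0 : ℝ), g t * ((wrightPhi (-β) (1 - β) (-t) : ℝ) : 𝕜))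
      (𝓝[<] 1) (𝓝 (g 1)) := by
  have hI : ∀ β : ℝ, 0 < β → β < 1 → δ < 1 / (1 - β) →
      IntegrableOn (fun t : ℝ => g t * ((wrightPhi (-β) (1 - β) (-t) : ℝ) : 𝕜)) (Ioi 0) volume :=
    fun β hβ0 hβ1 hδ => integrableOn_Ioi_mul_of_eventually_le hint hgrowth
      (continuous_wrightPhi_neg hβ0.le hβ1 _) (eventually_exp_mul_wrightPhi_le hβ0 hβ1 hδ σ)
  refine ⟨hI, ?_⟩
  have hpeak := tendsto_setIntegral_peak_smul_of_integrableOn_of_tendsto (μ := volume)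
    (l := 𝓝[<] (1 : ℝ)) (φ := fun β t => wrightPhi (-β) (1 - β) (-t)) (g := g) (a := g 1)
    (x₀ := 1) (s := Ioc 0 2) measurableSet_Ioc measurableSet_Ioc Subset.rfl self_mem_nhdsWithin
    measure_Ioc_lt_top.ne ?_ (fun u hu h1u => tendstoUniformlyOn_wrightPhi hu h1u)
    tendsto_integral_wrightPhi_Ioc ?_ (hint 2 zero_lt_two) (hcont.mono_left nhdsWithin_le_nhds)
  · have h := hpeak.add (tendsto_setIntegral_Ioi_mul_wrightPhi hint hσ hgrowth)
    rw [add_zero] at h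
    refine h.congr' ?_
    filter_upwards [eventually_mem_Ioo_nhdsLT_one,
      tendsto_one_div_one_sub_atTop.eventually (eventually_gt_atTop δ)] with β hβ hδ
    have hint' := hI β hβ.1 hβ.2 hδ
    rw [← Ioc_union_Ioi_eq_Ioi (zero_le_two (α := ℝ)), setIntegral_union
      (Ioc_disjoint_Ioi le_rfl) measurableSet_Ioi (hint'.mono_set Ioc_subset_Ioi_self)
      (hint'.mono_set (Ioi_subset_Ioi zero_le_two))]
    congr 1
    refine integral_congr_ae (Eventually.of_forall fun t => ?_)
    dsimp only
    rw [RCLike.real_smul_eq_coe_mul, mul_comm]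
  · filter_upwards [eventually_mem_Ioo_nhdsLT_one] with β hβ t ht
    exact wrightPhi_neg_nonneg hβ.1.le hβ.2 (by linarith [hβ.2]) ht.1.le
  · filter_upwards [eventually_mem_Ioo_nhdsLT_one] with β hβ
    exact (continuous_wrightPhi_neg hβ.1.le hβ.2 _).aestronglyMeasurable
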